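/- Let $T$ be a real random variable with $T\ge 0$ almost surely (in particular, any positive random variable), let $\Phi(\omega)=\langle e^{i\omega T}\rangle$ be its characteristic function, let $\langle T\rangle\in[0,\infty]$ be its expectation, and let $\Delta\ge 0$ be a real number. Then $$\sup_{\omega\in\mathbb{R},\ |\omega|\ge\Delta}|\Phi(\omega)|\;\ge\; e^{-\frac{\pi}{2}\,\Delta\,\langle T\rangle},$$ where $e^{-\infty}=0$ and $0\cdot\infty=0$. Consequently, if $\Delta>0$, $\epsilon>0$ and $|\Phi(\omega)|\le\epsilon$ for all real $\omega$ with $|\omega|\ge\Delta$, then $$\langle T\rangle\;\ge\;\frac{2}{\pi\Delta}\,\log\frac1\epsilon .$$ -/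

import Mathlib

open Complex Filter Topology MeasureTheory ProbabilityTheory

/-! ### The conformal map from the strip `0 < re ζ < 1` to the left half-plane -/

/-! The Laplace transform `G u = 𝔼 exp (u T)` is holomorphic for `re u < 0`, bounded by `1` up to
the imaginary axis, and equal to `Φ` on that axis. Seen from `-Δ tan (π t / 2)`, the set `|ω| ≥ Δ`
has harmonic measure `t`, so `|Φ| ≤ ε` there forces `|G| ≤ ε ^ t` at this point
(`norm_le_rpow_of_diffContOnCl_left_half_plane`: Hadamard's three lines theorem after a conformal
map). Jensen bounds `G` below by `exp (-Δ tan (π t / 2) ⟨T⟩)`. Comparing logarithms, dividing by `t`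
and letting `t → 0` produces the constant `π / 2`. -/

/-- The conformal map of the strip `0 < re ζ < 1` onto the left half-plane that sends the line
`re ζ = 1` to the segment `{i ω : |ω| < Δ}`, the line `re ζ = 0` to `{i ω : |ω| > Δ}`, and
`ζ = 0` to infinity. -/
noncomputable def stripToLeftHalfPlane (Δ : ℝ) (ζ : ℂ) : ℂ :=
  I * Δ * ((1 + cexp (Real.pi * I * ζ)) / (1 - cexp (Real.pi * I * ζ)))

/-- The conformal map factors through `q = exp (π i ζ)`, which takes the strip to the upper
half-plane; the sign of `q.im` then decides the half-plane of the image. -/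
lemma re_I_mul_one_add_div_one_sub (Δ : ℝ) (q : ℂ) :
    (I * Δ * ((1 + q) / (1 - q))).re = -(2 * Δ * q.im / normSq (1 - q)) := by
  simp [div_re, div_im]
  ring

lemma im_exp_pi_I_mul (ζ : ℂ) :
    (cexp (Real.pi * I * ζ)).im = Real.exp (-(Real.pi * ζ.im)) * Real.sin (Real.pi * ζ.re) := by
  simp [exp_im]

lemma im_exp_pi_I_mul_nonneg {ζ : ℂ} (h₀ : 0 ≤ ζ.re) (h₁ : ζ.re ≤ 1) :
    0 ≤ (cexp (Real.pi * I * ζ)).im := by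
  rw [im_exp_pi_I_mul]
  refine mul_nonneg (Real.exp_nonneg _) (Real.sin_nonneg_of_nonneg_of_le_pi ?_ ?_)
  · positivity
  · nlinarith [Real.pi_pos]

lemma im_exp_pi_I_mul_pos {ζ : ℂ} (h₀ : 0 < ζ.re) (h₁ : ζ.re < 1) :
    0 < (cexp (Real.pi * I * ζ)).im := by
  rw [im_exp_pi_I_mul]
  refine mul_pos (Real.exp_pos _) (Real.sin_pos_of_pos_of_lt_pi ?_ ?_)
  · positivity
  · nlinarith [Real.pi_pos]

lemma one_sub_ne_zero_of_im_pos {q : ℂ} (hq : 0 < q.im) : 1 - q ≠ 0 := by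
  intro h
  have := congrArg im h
  simp at this
  linarith

lemma re_stripToLeftHalfPlane_nonpos {Δ : ℝ} (hΔ : 0 ≤ Δ) {ζ : ℂ} (h₀ : 0 ≤ ζ.re)
    (h₁ : ζ.re ≤ 1) : (stripToLeftHalfPlane Δ ζ).re ≤ 0 := by
  rw [stripToLeftHalfPlane, re_I_mul_one_add_div_one_sub, neg_nonpos]
  have := im_exp_pi_I_mul_nonneg h₀ h₁
  exact div_nonneg (by positivity) (normSq_nonneg _)

lemma re_stripToLeftHalfPlane_neg {Δ : ℝ} (hΔ : 0 < Δ) {ζ : ℂ} (h₀ : 0 < ζ.re)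
    (h₁ : ζ.re < 1) : (stripToLeftHalfPlane Δ ζ).re < 0 := by
  rw [stripToLeftHalfPlane, re_I_mul_one_add_div_one_sub, neg_lt_zero]
  have := im_exp_pi_I_mul_pos h₀ h₁
  exact div_pos (by positivity) (normSq_pos.2 (one_sub_ne_zero_of_im_pos this))

lemma differentiableAt_stripToLeftHalfPlane (Δ : ℝ) {ζ : ℂ}
    (h : 1 - cexp (Real.pi * I * ζ) ≠ 0) :
    DifferentiableAt ℂ (stripToLeftHalfPlane Δ) ζ := by
  unfold stripToLeftHalfPlane
  have hn : DifferentiableAt ℂ (fun ζ : ℂ ↦ 1 + cexp (Real.pi * I * ζ)) ζ := by fun_prop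
  have hd : DifferentiableAt ℂ (fun ζ : ℂ ↦ 1 - cexp (Real.pi * I * ζ)) ζ := by fun_prop
  exact (hn.div hd h).const_mul _

/-- On the line `re ζ = 0` the conformal map takes values `i ω` with `|ω| ≥ Δ`. -/
lemma exists_stripToLeftHalfPlane_eq_mul_I {Δ : ℝ} (hΔ : 0 ≤ Δ) {ζ : ℂ} (h₀ : ζ.re = 0)
    (h : 1 - cexp (Real.pi * I * ζ) ≠ 0) :
    ∃ ω : ℝ, Δ ≤ |ω| ∧ stripToLeftHalfPlane Δ ζ = ω * I := by
  obtain ⟨r, hr, hq⟩ : ∃ r : ℝ, 0 < r ∧ cexp (Real.pi * I * ζ) = r := by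
    refine ⟨Real.exp (-(Real.pi * ζ.im)), Real.exp_pos _, ?_⟩
    have : ζ = ζ.im * I := by apply Complex.ext <;> simp [h₀]
    rw [this]
    push_cast
    congr 1
    simp only [mul_im, ofReal_im, I_re, ofReal_re, I_im, mul_zero, mul_one, add_zero]
    linear_combination (Real.pi * ζ.im : ℂ) * I_mul_I
  have hr1 : 1 - r ≠ 0 := by
    rw [hq] at h
    exact_mod_cast h
  refine ⟨Δ * ((1 + r) / (1 - r)), ?_, ?_⟩
  · rw [abs_mul, abs_of_nonneg hΔ, abs_div]
    refine le_mul_of_one_le_right hΔ ((one_le_div (abs_pos.2 hr1)).2 ?_)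
    rw [abs_of_pos (by linarith : 0 < 1 + r)]
    exact abs_le.2 ⟨by linarith, by linarith⟩
  · rw [stripToLeftHalfPlane, hq]
    push_cast
    ring

/-- With `θ = π t / 2`, `q = -exp (-2 i θ)`; a common factor `exp (-i θ)` cancels from `1 + q` and
`1 - q`, leaving `i tan θ`. -/
lemma stripToLeftHalfPlane_one_sub {Δ t : ℝ} (h₀ : 0 < t) (h₁ : t < 1) :
    stripToLeftHalfPlane Δ ((1 - t : ℝ) : ℂ) = ((-(Δ * Real.tan (Real.pi / 2 * t)) : ℝ) : ℂ) := by
  set θ : ℝ := Real.pi / 2 * t with hθ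
  have hcos : Real.cos θ ≠ 0 :=
    (Real.cos_pos_of_mem_Ioo ⟨by nlinarith [Real.pi_pos], by nlinarith [Real.pi_pos]⟩).ne'
  have hq : cexp (Real.pi * I * ((1 - t : ℝ) : ℂ)) =
      -((Real.cos θ - Real.sin θ * I) * (Real.cos θ - Real.sin θ * I)) := by
    have h1 : (Real.cos θ - Real.sin θ * I : ℂ) = cexp (-(θ * I)) := by
      rw [← neg_mul, exp_mul_I]
      simp [sub_eq_add_neg]
    rw [h1, ← Complex.exp_add]
    have h2 : (Real.pi * I * ((1 - t : ℝ) : ℂ) : ℂ) = Real.pi * I + (-(θ * I) + -(θ * I)) := by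
      rw [hθ]; push_cast; ring
    rw [h2, Complex.exp_add, exp_pi_mul_I]
    ring
  have hsq : (Real.cos θ : ℂ) ^ 2 + (Real.sin θ : ℂ) ^ 2 = 1 := by
    exact_mod_cast Real.cos_sq_add_sin_sq θ
  have hcos' : (Real.cos θ : ℂ) ≠ 0 := by exact_mod_cast hcos
  have hne : (Real.cos θ - Real.sin θ * I : ℂ) ≠ 0 := by
    intro h
    have := congrArg re h
    simp [-ofReal_cos, -ofReal_sin] at this
    exact hcos this
  have hnum : 1 + cexp (Real.pi * I * ((1 - t : ℝ) : ℂ)) =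
      2 * I * Real.sin θ * (Real.cos θ - Real.sin θ * I) := by
    rw [hq]
    linear_combination (-1 : ℂ) * hsq + (Real.sin θ : ℂ) ^ 2 * I_sq
  have hden : 1 - cexp (Real.pi * I * ((1 - t : ℝ) : ℂ)) =
      2 * Real.cos θ * (Real.cos θ - Real.sin θ * I) := by
    rw [hq]
    linear_combination (-1 : ℂ) * hsq + (Real.sin θ : ℂ) ^ 2 * I_sq
  rw [stripToLeftHalfPlane, hnum, hden, Real.tan_eq_sin_div_cos, mul_div_mul_right _ _ hne]
  push_cast [-ofReal_cos, -ofReal_sin]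
  field_simp
  linear_combination (Δ * Real.sin θ : ℂ) * I_sq

/-! ### A two-constants theorem in the left half-plane -/

/-- The factor `1 / (1 - s u)`, with `u` the image of `ζ` under the conformal map, extended by
`0` to the preimage of infinity. -/
noncomputable def stripDamping (Δ s : ℝ) (ζ : ℂ) : ℂ :=
  (1 - cexp (Real.pi * I * ζ)) /
    ((1 - cexp (Real.pi * I * ζ)) - s * (I * Δ * (1 + cexp (Real.pi * I * ζ))))

lemma one_le_norm_one_sub_mul {s : ℝ} (hs : 0 ≤ s) {u : ℂ} (hu : u.re ≤ 0) :
    1 ≤ ‖1 - s * u‖ := by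
  refine le_trans ?_ (re_le_norm _)
  simp
  nlinarith

lemma stripDamping_denom_eq {Δ s : ℝ} {ζ : ℂ} (h : 1 - cexp (Real.pi * I * ζ) ≠ 0) :
    (1 - cexp (Real.pi * I * ζ)) - s * (I * Δ * (1 + cexp (Real.pi * I * ζ))) =
      (1 - cexp (Real.pi * I * ζ)) * (1 - s * stripToLeftHalfPlane Δ ζ) := by
  rw [stripToLeftHalfPlane]
  field_simp

lemma stripDamping_eq {Δ s : ℝ} {ζ : ℂ} (h : 1 - cexp (Real.pi * I * ζ) ≠ 0) :
    stripDamping Δ s ζ = (1 - s * stripToLeftHalfPlane Δ ζ)⁻¹ := by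
  rw [stripDamping, stripDamping_denom_eq h, div_mul_cancel_left₀ h]

lemma stripDamping_denom_ne_zero {Δ s : ℝ} (hΔ : 0 < Δ) (hs : 0 < s) {ζ : ℂ} (h₀ : 0 ≤ ζ.re)
    (h₁ : ζ.re ≤ 1) :
    (1 - cexp (Real.pi * I * ζ)) - s * (I * Δ * (1 + cexp (Real.pi * I * ζ))) ≠ 0 := by
  by_cases h : 1 - cexp (Real.pi * I * ζ) = 0
  -- At `q = 1` the denominator is `-2 i s Δ`.
  · rw [h, ← sub_eq_zero.1 h]
    have : (s : ℂ) ≠ 0 := by exact_mod_cast hs.ne'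
    have : (Δ : ℂ) ≠ 0 := by exact_mod_cast hΔ.ne'
    norm_num [*]
  · rw [stripDamping_denom_eq h]
    refine mul_ne_zero h (norm_pos_iff.1 ?_)
    exact one_pos.trans_le
      (one_le_norm_one_sub_mul hs.le (re_stripToLeftHalfPlane_nonpos hΔ.le h₀ h₁))

lemma norm_stripDamping_le_one {Δ s : ℝ} (hΔ : 0 < Δ) (hs : 0 < s) {ζ : ℂ} (h₀ : 0 ≤ ζ.re)
    (h₁ : ζ.re ≤ 1) : ‖stripDamping Δ s ζ‖ ≤ 1 := by
  by_cases h : 1 - cexp (Real.pi * I * ζ) = 0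
  · simp [stripDamping, h]
  · rw [stripDamping_eq h, norm_inv]
    exact inv_le_one_of_one_le₀
      (one_le_norm_one_sub_mul hs.le (re_stripToLeftHalfPlane_nonpos hΔ.le h₀ h₁))

lemma differentiableAt_stripDamping {Δ s : ℝ} (hΔ : 0 < Δ) (hs : 0 < s) {ζ : ℂ}
    (h₀ : 0 ≤ ζ.re) (h₁ : ζ.re ≤ 1) : DifferentiableAt ℂ (stripDamping Δ s) ζ := by
  unfold stripDamping
  exact DifferentiableAt.div (by fun_prop) (by fun_prop) (stripDamping_denom_ne_zero hΔ hs h₀ h₁)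

lemma diffContOnCl_comp_mul_stripDamping {G : ℂ → ℂ} (hG : DiffContOnCl ℂ G {u | u.re < 0})
    (hG1 : ∀ u : ℂ, u.re ≤ 0 → ‖G u‖ ≤ 1) {Δ s : ℝ} (hΔ : 0 < Δ) (hs : 0 < s) :
    DiffContOnCl ℂ (fun ζ ↦ G (stripToLeftHalfPlane Δ ζ) * stripDamping Δ s ζ)
      (HadamardThreeLines.verticalStrip 0 1) := by
  have hopen : IsOpen {u : ℂ | u.re < 0} := isOpen_lt continuous_re continuous_const
  have hcl : closure {u : ℂ | u.re < 0} = {u | u.re ≤ 0} := closure_setOfPred_re_lt 0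
  refine ⟨fun ζ hζ ↦ ?_, fun ζ hζ ↦ ?_⟩
  · have hq := one_sub_ne_zero_of_im_pos (im_exp_pi_I_mul_pos hζ.1 hζ.2)
    refine DifferentiableAt.differentiableWithinAt (DifferentiableAt.mul ?_
      (differentiableAt_stripDamping hΔ hs hζ.1.le hζ.2.le))
    exact DifferentiableAt.comp ζ
      (hG.differentiableAt hopen (re_stripToLeftHalfPlane_neg hΔ hζ.1 hζ.2))
      (differentiableAt_stripToLeftHalfPlane Δ hq)
  · rw [HadamardThreeLines.verticalStrip, closure_preimage_re, closure_Ioo zero_ne_one] at hζ ⊢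
    have hD := (differentiableAt_stripDamping hΔ hs hζ.1 hζ.2).continuousAt.continuousWithinAt
      (s := re ⁻¹' Set.Icc 0 1)
    by_cases hq : 1 - cexp (Real.pi * I * ζ) = 0
    · have h0 : stripDamping Δ s ζ = 0 := by simp [stripDamping, hq]
      rw [ContinuousWithinAt, h0] at hD
      rw [ContinuousWithinAt, h0, mul_zero]
      -- At the preimage of infinity `G` need not have a limit; its boundedness and the vanishing of
      -- the damping factor suffice.
      refine squeeze_zero_norm' ?_ (tendsto_zero_iff_norm_tendsto_zero.1 hD)
      filter_upwards [self_mem_nhdsWithin] with z hz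
      rw [norm_mul]
      exact mul_le_of_le_one_left (norm_nonneg _)
        (hG1 _ (re_stripToLeftHalfPlane_nonpos hΔ.le hz.1 hz.2))
    · refine ContinuousWithinAt.mul ?_ hD
      have hc := hG.continuousOn
      rw [hcl] at hc
      exact (hc _ (re_stripToLeftHalfPlane_nonpos hΔ.le hζ.1 hζ.2)).comp
        (differentiableAt_stripToLeftHalfPlane Δ hq).continuousAt.continuousWithinAt
        fun z hz ↦ re_stripToLeftHalfPlane_nonpos hΔ.le hz.1 hz.2

/-- **Two-constants theorem.** If `G` is holomorphic in the left half-plane, continuous and bounded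
by `1` on its closure, and bounded by `ε` on the part `|ω| ≥ Δ` of the imaginary axis, then at a
point of the negative real axis it is bounded by `ε` to the power of the harmonic measure of that
part. -/
theorem norm_le_rpow_of_diffContOnCl_left_half_plane {G : ℂ → ℂ}
    (hG : DiffContOnCl ℂ G {u | u.re < 0}) (hG1 : ∀ u : ℂ, u.re ≤ 0 → ‖G u‖ ≤ 1)
    {Δ ε : ℝ} (hΔ : 0 < Δ) (hε : 0 ≤ ε) (hGε : ∀ ω : ℝ, Δ ≤ |ω| → ‖G (ω * I)‖ ≤ ε)
    {t : ℝ} (h₀ : 0 < t) (h₁ : t < 1) :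
    ‖G ((-(Δ * Real.tan (Real.pi / 2 * t)) : ℝ) : ℂ)‖ ≤ ε ^ t := by
  set u : ℂ := ((-(Δ * Real.tan (Real.pi / 2 * t)) : ℝ) : ℂ) with hu
  have hre : ((1 - t : ℝ) : ℂ).re = 1 - t := ofReal_re _
  have hq : 1 - cexp (Real.pi * I * ((1 - t : ℝ) : ℂ)) ≠ 0 :=
    one_sub_ne_zero_of_im_pos (im_exp_pi_I_mul_pos (by rw [hre]; linarith) (by rw [hre]; linarith))
  have hu0 : u.re ≤ 0 := by
    rw [hu, ← stripToLeftHalfPlane_one_sub h₀ h₁]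
    exact re_stripToLeftHalfPlane_nonpos hΔ.le (by rw [hre]; linarith) (by rw [hre]; linarith)
  have key : ∀ s : ℝ, 0 < s → ‖G u‖ ≤ ε ^ t * ‖1 - s * u‖ := by
    intro s hs
    have hbound : ∀ z : ℂ, 0 ≤ z.re → z.re ≤ 1 →
        ‖G (stripToLeftHalfPlane Δ z) * stripDamping Δ s z‖ ≤ 1 := fun z hz₀ hz₁ ↦ by
      rw [norm_mul]
      exact mul_le_one₀ (hG1 _ (re_stripToLeftHalfPlane_nonpos hΔ.le hz₀ hz₁)) (norm_nonneg _)
        (norm_stripDamping_le_one hΔ hs hz₀ hz₁)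
    -- At abscissa `1 - t`, the bound `ε` on `re ζ = 0` gets the exponent `1 - (1 - t) = t`.
    have h := HadamardThreeLines.norm_le_interp_of_mem_verticalClosedStrip₀₁'
      (fun ζ ↦ G (stripToLeftHalfPlane Δ ζ) * stripDamping Δ s ζ) (z := ((1 - t : ℝ) : ℂ))
      (a := ε) (b := 1)
      ⟨by rw [hre]; linarith, by rw [hre]; linarith⟩
      (diffContOnCl_comp_mul_stripDamping hG hG1 hΔ hs)
      ⟨1, by rintro _ ⟨z, hz, rfl⟩; exact hbound z hz.1 hz.2⟩
      (fun z hz ↦ by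
        have hz : z.re = 0 := hz
        by_cases hqz : 1 - cexp (Real.pi * I * z) = 0
        · simpa [stripDamping, hqz] using hε
        · obtain ⟨ω, hω, hωz⟩ := exists_stripToLeftHalfPlane_eq_mul_I hΔ.le hz hqz
          rw [norm_mul, hωz]
          refine (mul_le_of_le_one_right (norm_nonneg _) ?_).trans (hGε ω hω)
          exact norm_stripDamping_le_one hΔ hs hz.ge (by linarith))
      (fun z hz ↦ by
        have hz : z.re = 1 := hz
        exact hbound z (by linarith) hz.le)
    rw [stripDamping_eq hq, stripToLeftHalfPlane_one_sub h₀ h₁, ← hu, hre, sub_sub_cancel,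
      Real.one_rpow, mul_one, norm_mul, norm_inv] at h
    have hpos := one_pos.trans_le (one_le_norm_one_sub_mul hs.le hu0)
    exact (mul_inv_le_iff₀ hpos).1 h
  -- Letting `s → 0` removes the damping.
  have hlim : Tendsto (fun s : ℝ ↦ ε ^ t * ‖1 - s * u‖) (𝓝[>] 0) (𝓝 (ε ^ t)) := by
    have : Continuous fun s : ℝ ↦ ε ^ t * ‖1 - s * u‖ := by fun_prop
    simpa using (this.tendsto 0).mono_left nhdsWithin_le_nhds
  exact ge_of_tendsto hlim (by filter_upwards [self_mem_nhdsWithin] with s hs using key s hs)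

/-! ### The moment generating function of a nonnegative random variable -/

section MGF

variable {Ω : Type*} [MeasurableSpace Ω] {P : Measure Ω} [IsProbabilityMeasure P] {T : Ω → ℝ}

lemma integrable_exp_mul_of_nonpos (hT : AEMeasurable T P) (hpos : ∀ᵐ x ∂P, 0 ≤ T x) {y : ℝ}
    (hy : y ≤ 0) : Integrable (fun x ↦ Real.exp (y * T x)) P := by
  refine Integrable.of_bound (by fun_prop) 1 ?_
  filter_upwards [hpos] with x hx
  rw [Real.norm_eq_abs, abs_of_pos (Real.exp_pos _), Real.exp_le_one_iff]
  exact mul_nonpos_of_nonpos_of_nonneg hy hx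

lemma norm_complexMGF_le_one (hpos : ∀ᵐ x ∂P, 0 ≤ T x) {u : ℂ} (hu : u.re ≤ 0) :
    ‖complexMGF T P u‖ ≤ 1 := by
  have := norm_integral_le_of_norm_le_const (μ := P) (f := fun x ↦ cexp (u * T x)) (C := 1) (by
    filter_upwards [hpos] with x hx
    rw [norm_exp, Real.exp_le_one_iff]
    simpa using mul_nonpos_of_nonpos_of_nonneg hu hx)
  simpa [complexMGF] using this

lemma diffContOnCl_complexMGF (hT : AEMeasurable T P) (hpos : ∀ᵐ x ∂P, 0 ≤ T x) :
    DiffContOnCl ℂ (complexMGF T P) {u | u.re < 0} := by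
  constructor
  · refine differentiableOn_complexMGF.mono fun u (hu : u.re < 0) ↦ ?_
    refine mem_interior.2 ⟨Set.Iio 0, fun y hy ↦ ?_, isOpen_Iio, hu⟩
    exact integrable_exp_mul_of_nonpos hT hpos (le_of_lt hy)
  · rw [closure_setOfPred_re_lt]
    refine continuousOn_of_dominated (bound := fun _ ↦ 1) (fun u _ ↦ by fun_prop) ?_
      (integrable_const 1) (ae_of_all _ fun x ↦ by fun_prop)
    intro u (hu : u.re ≤ 0)
    filter_upwards [hpos] with x hx
    rw [norm_exp, Real.exp_le_one_iff]
    simpa using mul_nonpos_of_nonpos_of_nonneg hu hx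

/-- Jensen's inequality for the Laplace transform. -/
lemma exp_mul_integral_le_mgf (hT : AEMeasurable T P) (hpos : ∀ᵐ x ∂P, 0 ≤ T x)
    (hint : Integrable T P) {y : ℝ} (hy : y ≤ 0) :
    Real.exp (y * ∫ x, T x ∂P) ≤ mgf T P y := by
  have := convexOn_exp.map_integral_le (μ := P) (f := fun x ↦ y * T x)
    Real.continuous_exp.continuousOn isClosed_univ (by simp) (hint.const_mul y)
    (integrable_exp_mul_of_nonpos hT hpos hy)
  rwa [integral_const_mul] at this

end MGF

/-! ### The lower bound on the mean -/

/-- The quotient is the slope of `tan (a t)` at `0`. -/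
lemma tendsto_tan_mul_div (a : ℝ) :
    Tendsto (fun t : ℝ ↦ Real.tan (a * t) / t) (𝓝[>] 0) (𝓝 a) := by
  have h1 : HasDerivAt Real.tan (1 / Real.cos (a * 0) ^ 2) (a * 0) :=
    Real.hasDerivAt_tan (by simp)
  have h2 : HasDerivAt (fun t : ℝ ↦ Real.tan (a * t)) (1 / Real.cos (a * 0) ^ 2 * (a * 1)) 0 :=
    h1.comp 0 ((hasDerivAt_id (0 : ℝ)).const_mul a)
  have h3 := (hasDerivAt_iff_tendsto_slope.1 h2).mono_left
    (nhdsWithin_mono (0 : ℝ) (t := {0}ᶜ) (s := Set.Ioi 0) fun t ht ↦ ne_of_gt ht)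
  simpa [slope_fun_def_field] using h3

theorem exp_neg_integral_le_of_norm_charFun_le {Ω : Type*} [MeasurableSpace Ω] {P : Measure Ω}
    [IsProbabilityMeasure P] {T : Ω → ℝ} (hpos : ∀ᵐ x ∂P, 0 ≤ T x) (hint : Integrable T P)
    {Δ ε : ℝ} (hΔ : 0 < Δ) (hε : 0 < ε)
    (h : ∀ ω : ℝ, Δ ≤ |ω| → ‖charFun (P.map T) ω‖ ≤ ε) :
    Real.exp (-(Real.pi / 2 * Δ * ∫ x, T x ∂P)) ≤ ε := by
  have hT := hint.aemeasurable
  rw [← Real.le_log_iff_exp_le hε]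
  set m := ∫ x, T x ∂P
  have key : ∀ t ∈ Set.Ioo (0 : ℝ) 1,
      -(Δ * m * (Real.tan (Real.pi / 2 * t) / t)) ≤ Real.log ε := by
    rintro t ⟨h₀, h₁⟩
    have htan : 0 ≤ Real.tan (Real.pi / 2 * t) :=
      Real.tan_nonneg_of_nonneg_of_le_pi_div_two (by positivity) (by nlinarith [Real.pi_pos])
    have h1 := norm_le_rpow_of_diffContOnCl_left_half_plane (diffContOnCl_complexMGF hT hpos)
      (fun u hu ↦ norm_complexMGF_le_one hpos hu) hΔ hε.le
      (fun ω hω ↦ by rw [complexMGF_mul_I hT]; exact h ω hω) h₀ h₁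
    rw [complexMGF_ofReal, norm_real] at h1
    have h2 := (exp_mul_integral_le_mgf hT hpos hint
      (neg_nonpos.2 (mul_nonneg hΔ.le htan))).trans ((le_abs_self _).trans h1)
    rw [Real.rpow_def_of_pos hε, Real.exp_le_exp] at h2
    have h3 : -(Δ * m * (Real.tan (Real.pi / 2 * t) / t)) =
        -(Δ * Real.tan (Real.pi / 2 * t)) * m / t := by ring
    rw [h3]
    exact (div_le_iff₀ h₀).2 h2
  have hlim := ((tendsto_tan_mul_div (Real.pi / 2)).const_mul (Δ * m)).neg
  rw [show Real.pi / 2 * Δ * m = Δ * m * (Real.pi / 2) by ring]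
  exact le_of_tendsto hlim (by
    filter_upwards [Ioo_mem_nhdsGT (zero_lt_one' ℝ)] with t ht using key t ht)

/-- Lower bound for positive evolution times. The mean `∫⁻ x, ENNReal.ofReal (T x) ∂P` of the
nonnegative random variable `T` may be `∞`; then the exponential is `exp (-∞) = 0` for `Δ > 0`.
The supremum is taken in `[0, ∞]`. -/
theorem mainTheorem3 {Ω : Type*} [MeasurableSpace Ω]
    (P : MeasureTheory.Measure Ω) [MeasureTheory.IsProbabilityMeasure P]
    (T : Ω → ℝ) (hT : AEMeasurable T P) (hpos : ∀ᵐ x ∂P, 0 ≤ T x)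
    (Δ : ℝ) (hΔ : 0 ≤ Δ) :
    (EReal.exp (-(((Real.pi / 2 * Δ : ℝ) : EReal) *
        ((∫⁻ x, ENNReal.ofReal (T x) ∂P : ENNReal) : EReal))) ≤
      ⨆ ω : {ω : ℝ // Δ ≤ |ω|}, ‖MeasureTheory.charFun (P.map T) (ω : ℝ)‖ₑ) ∧
    (0 < Δ → ∀ ε : ℝ, 0 < ε →
      (∀ ω : ℝ, Δ ≤ |ω| → ‖MeasureTheory.charFun (P.map T) ω‖ ≤ ε) →
      ENNReal.ofReal (2 / (Real.pi * Δ) * Real.log (1 / ε)) ≤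
        ∫⁻ x, ENNReal.ofReal (T x) ∂P) := by
  have hprob : IsProbabilityMeasure (P.map T) := Measure.isProbabilityMeasure_map hT
  have hfin : ∫⁻ x, ENNReal.ofReal (T x) ∂P ≠ ⊤ → Integrable T P := fun h ↦
    (lintegral_ofReal_ne_top_iff_integrable hT.aestronglyMeasurable hpos).1 h
  have hmean : Integrable T P →
      ∫⁻ x, ENNReal.ofReal (T x) ∂P = ENNReal.ofReal (∫ x, T x ∂P) := fun h ↦
    (ofReal_integral_eq_lintegral_ofReal h hpos).symm
  constructor
  · rcases hΔ.eq_or_lt with rfl | hΔ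
    -- For `Δ = 0` the frequency `ω = 0` gives `Φ 0 = 1`; the left side is `1` even for infinite
    -- mean, as `0 * ⊤ = 0`.
    · refine le_trans ?_ (le_iSup (fun ω : {ω : ℝ // 0 ≤ |ω|} ↦
        ‖charFun (P.map T) (ω : ℝ)‖ₑ) ⟨0, abs_nonneg 0⟩)
      simp
    by_cases htop : ∫⁻ x, ENNReal.ofReal (T x) ∂P = ⊤
    · rw [htop, EReal.coe_ennreal_top, EReal.coe_mul_top_of_pos (by positivity)]
      simp
    have hint := hfin htop
    rw [hmean hint, EReal.coe_ennreal_ofReal, max_eq_left (integral_nonneg_of_ae hpos),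
      ← EReal.coe_mul, ← EReal.coe_neg, EReal.exp_coe]
    -- The real bound needs `ε > 0`, while the supremum is not known to be positive, so every `a`
    -- above it is used instead.
    refine le_of_forall_gt_imp_ge_of_dense fun a ha ↦ ?_
    rcases eq_or_ne a ⊤ with rfl | hatop
    · exact le_top
    have hapos : 0 < a.toReal := ENNReal.toReal_pos (pos_of_gt ha).ne' hatop
    rw [← ENNReal.ofReal_toReal hatop]
    refine ENNReal.ofReal_le_ofReal
      (exp_neg_integral_le_of_norm_charFun_le hpos hint hΔ hapos fun ω hω ↦ ?_)
    have := (le_iSup (fun ω : {ω : ℝ // Δ ≤ |ω|} ↦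
      ‖charFun (P.map T) (ω : ℝ)‖ₑ) ⟨ω, hω⟩).trans ha.le
    simpa using ENNReal.toReal_mono hatop this
  · intro hΔ ε hε h
    by_cases htop : ∫⁻ x, ENNReal.ofReal (T x) ∂P = ⊤
    · rw [htop]; exact le_top
    have hint := hfin htop
    rw [hmean hint]
    refine ENNReal.ofReal_le_ofReal ?_
    have := (Real.le_log_iff_exp_le hε).2
      (exp_neg_integral_le_of_norm_charFun_le hpos hint hΔ hε h)
    rw [one_div, Real.log_inv, div_mul_eq_mul_div, div_le_iff₀ (by positivity)]
    linarith
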